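/- Manifolds are smooth, finite-dimensional, Hausdorff and paracompact. A Lie groupoid $G=\{G_1\rightrightarrows G_0\}$ is a groupoid whose sets $G_0$ of objects and $G_1$ of arrows are manifolds, whose source and target maps $s,t:G_1\to G_0$ are submersions, and whose unit, inverse and multiplication maps are smooth. Let $\mathsf{Gp}$ be the category whose objects are Lie groupoids and whose morphisms $G\to H$ are isomorphism classes of smooth functors, two smooth functors $F,F':G\to H$ being isomorphic if there is a smooth natural transformation $G_0\to H_1$ from $F$ to $F'$. A smooth functor $F:G\to H$ is an equivalence of Lie groupoids if the map $G_1\to (G_0\times G_0)\times_{H_0\times H_0}H_1$, $\gamma\mapsto (s(\gamma),t(\gamma),F(\gamma))$, is a diffeomorphism and the map $G_0\times_{F,H_0,t}H_1\to H_0$, $(x,h)\mapsto s(h)$, is a surjective submersion. Let $W$ be the class of isomorphism classes of equivalences. A manifold $M$ is regarded as the Lie groupoid $\{M\rightrightarrows M\}$ with only identity arrows, and $\{\mathbb{Z}/2\rightrightarrows *\}$ is the Lie groupoid with one object and the discrete group $\mathbb{Z}/2$ as arrows. Then there is an open cover $\{U_1,U_2\}$ of $S^1$ such that, for every localization $L:\mathsf{Gp}\to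 \mathsf{Gp}[W^{-1}]$ of $\mathsf{Gp}$ at $W$, there are two morphisms $f,g: S^1\to\{\mathbb{Z}/2\rightrightarrows *\}$ in $\mathsf{Gp}[W^{-1}]$ with $f|_{U_1}=g|_{U_1}$ and $f|_{U_2}=g|_{U_2}$ but $f\neq g$. Here $f|_{U_i}=f\circ L([\iota_i])$, where $\iota_i:U_i\hookrightarrow S^1$ is the inclusion. -/

import Mathlib

open CategoryTheory TopologicalSpace Set
open scoped Manifold ContDiff

universe v u

/-- A (Hausdorff, paracompact, finite-dimensional, smooth) manifold without boundary. -/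
structure Mfd where
  carrier : Type
  dim : ℕ
  [topology : TopologicalSpace carrier]
  [charted : ChartedSpace (EuclideanSpace ℝ (Fin dim)) carrier]
  [isManifold : IsManifold (𝓡 dim) ∞ carrier]
  [t2 : T2Space carrier]
  [paracompact : ParacompactSpace carrier]

namespace Mfd

instance : CoeSort Mfd Type := ⟨Mfd.carrier⟩

attribute [instance] Mfd.topology Mfd.charted Mfd.isManifold Mfd.t2 Mfd.paracompact

/-- The type `M`, with its registered manifold structure, as a bundled manifold. -/
noncomputable abbrev of (M : Type) (n : ℕ) [TopologicalSpace M] [ChartedSpace (EuclideanSpace ℝ (Fin n)) M]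
    [IsManifold (𝓡 n) ∞ M] [T2Space M] [ParacompactSpace M] : Mfd where
  carrier := M
  dim := n

theorem paracompactSpace_of_discrete (X : Type) [TopologicalSpace X] [DiscreteTopology X] :
    ParacompactSpace X := by
  let _ := metrizableSpaceMetric X
  infer_instance

/-- A set, with the discrete topology, as a manifold of dimension `0`. -/
def discrete (X : Type) : Mfd :=
  letI : TopologicalSpace X := ⊥
  haveI : DiscreteTopology X := ⟨rfl⟩
  { carrier := X
    dim := 0
    topology := ⊥
    charted := ChartedSpace.ofDiscreteTopology
    isManifold := IsManifold.of_discreteTopology ∞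
    t2 := inferInstance
    paracompact := paracompactSpace_of_discrete X }

instance (X : Type) : DiscreteTopology (discrete X) := ⟨rfl⟩

/-- Smooth maps between manifolds. -/
abbrev Smooth {M N : Mfd} (f : M → N) : Prop := ContMDiff (𝓡 M.dim) (𝓡 N.dim) ∞ f

/-- Submersions between manifolds. -/
abbrev Submersion {M N : Mfd} (f : M → N) : Prop :=
  Manifold.IsSubmersion (𝓡 M.dim) (𝓡 N.dim) ∞ f

end Mfd

/-- For maps `f : X → Z` and `g : Y → Z`, a manifold `P` with maps `p : P → X`, `q : P → Y` is the
fiber product `X ×_Z Y` if `(p, q)` is a diffeomorphism from `P` onto the subset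
`{(x, y) | f x = g y}` of `X × Y`, viewed as an embedded submanifold: that is, if `(p, q)` is a
smooth embedding with this image. -/
def IsFiberProduct {EX HX EY HY : Type} [NormedAddCommGroup EX] [NormedSpace ℝ EX]
    [TopologicalSpace HX] [NormedAddCommGroup EY] [NormedSpace ℝ EY] [TopologicalSpace HY]
    (I : ModelWithCorners ℝ EX HX) (J : ModelWithCorners ℝ EY HY)
    {X Y Z : Type} [TopologicalSpace X] [ChartedSpace HX X] [TopologicalSpace Y]
    [ChartedSpace HY Y] (f : X → Z) (g : Y → Z) {P : Mfd} (p : P → X) (q : P → Y) : Prop :=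
  Manifold.IsSmoothEmbedding (𝓡 P.dim) (I.prod J) ∞ (fun x => (p x, q x)) ∧
    range (fun x => (p x, q x)) = {z : X × Y | f z.1 = g z.2}

/-- A Lie groupoid `{Arr ⇉ Obj}`. The arrow `comp g h _` is the composite `g ∘ h`, defined when the
source of `g` is the target of `h`. -/
structure LieGroupoid where
  Obj : Mfd
  Arr : Mfd
  src : Arr → Obj
  tgt : Arr → Obj
  unit : Obj → Arr
  inv : Arr → Arr
  comp : (g h : Arr) → src g = tgt h → Arr
  src_unit : ∀ x, src (unit x) = x
  tgt_unit : ∀ x, tgt (unit x) = x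
  src_inv : ∀ g, src (inv g) = tgt g
  tgt_inv : ∀ g, tgt (inv g) = src g
  src_comp : ∀ g h e, src (comp g h e) = src h
  tgt_comp : ∀ g h e, tgt (comp g h e) = tgt g
  unit_comp : ∀ g, comp (unit (tgt g)) g (src_unit _) = g
  comp_unit : ∀ g, comp g (unit (src g)) (tgt_unit _).symm = g
  inv_comp : ∀ g, comp (inv g) g (src_inv g) = unit (src g)
  comp_inv : ∀ g, comp g (inv g) (tgt_inv g).symm = unit (tgt g)
  assoc : ∀ g h k (e : src g = tgt h) (e' : src h = tgt k),
    comp (comp g h e) k ((src_comp g h e).trans e') =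
      comp g (comp h k e') (e.trans (tgt_comp h k e').symm)
  submersion_src : Mfd.Submersion src
  submersion_tgt : Mfd.Submersion tgt
  smooth_unit : Mfd.Smooth unit
  smooth_inv : Mfd.Smooth inv
  /-- The multiplication is smooth on the submanifold of composable pairs of `Arr × Arr`; here `m`
  is the multiplication, extended by arbitrary values outside this set. -/
  smooth_comp : ∀ m : Arr → Arr → Arr, (∀ g h e, m g h = comp g h e) →
    ContMDiffOn ((𝓡 Arr.dim).prod (𝓡 Arr.dim)) (𝓡 Arr.dim) ∞ (fun p : Arr × Arr => m p.1 p.2)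
      {p | src p.1 = tgt p.2}

namespace LieGroupoid

theorem smooth_comp' (G : LieGroupoid) {N : Mfd} {a b : N → G.Arr} (ha : Mfd.Smooth a)
    (hb : Mfd.Smooth b) (e : ∀ x, G.src (a x) = G.tgt (b x)) :
    Mfd.Smooth (fun x => G.comp (a x) (b x) (e x)) := by
  classical
  have h := G.smooth_comp (fun g h => if e : G.src g = G.tgt h then G.comp g h e else g)
    (fun g h e => by simp [e])
  have h2 := h.comp_contMDiff (ha.prodMk hb) (fun x => e x)
  refine h2.congr (fun x => ?_)
  simp [e x]

theorem comp_congr (G : LieGroupoid) {g g' h h' : G.Arr} (hg : g = g') (hh : h = h')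
    (e : G.src g = G.tgt h) (e' : G.src g' = G.tgt h') : G.comp g h e = G.comp g' h' e' := by
  subst hg hh
  rfl

/-- A smooth functor between Lie groupoids. -/
@[ext]
structure SmoothFunctor (G H : LieGroupoid) where
  obj : G.Obj → H.Obj
  arr : G.Arr → H.Arr
  smooth_obj : Mfd.Smooth obj
  smooth_arr : Mfd.Smooth arr
  src_arr : ∀ g, H.src (arr g) = obj (G.src g)
  tgt_arr : ∀ g, H.tgt (arr g) = obj (G.tgt g)
  arr_unit : ∀ x, arr (G.unit x) = H.unit (obj x)
  arr_comp : ∀ g h e, arr (G.comp g h e) =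
    H.comp (arr g) (arr h) (((src_arr g).trans (congrArg obj e)).trans (tgt_arr h).symm)

namespace SmoothFunctor

/-- The identity functor. -/
def id (G : LieGroupoid) : SmoothFunctor G G where
  obj := fun x => x
  arr := fun g => g
  smooth_obj := contMDiff_id
  smooth_arr := contMDiff_id
  src_arr _ := rfl
  tgt_arr _ := rfl
  arr_unit _ := rfl
  arr_comp _ _ _ := rfl

/-- The composite of `F : G → H` and `F' : H → K`. -/
def comp {G H K : LieGroupoid} (F : SmoothFunctor G H) (F' : SmoothFunctor H K) :
    SmoothFunctor G K where
  obj := fun x => F'.obj (F.obj x)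
  arr := fun g => F'.arr (F.arr g)
  smooth_obj := F'.smooth_obj.comp F.smooth_obj
  smooth_arr := F'.smooth_arr.comp F.smooth_arr
  src_arr g := by rw [F'.src_arr, F.src_arr]
  tgt_arr g := by rw [F'.tgt_arr, F.tgt_arr]
  arr_unit x := by rw [F.arr_unit, F'.arr_unit]
  arr_comp g h e := by
    rw [F.arr_comp, F'.arr_comp]

end SmoothFunctor

/-- A smooth natural transformation (automatically an isomorphism) between smooth functors. -/
structure SmoothNatTrans {G H : LieGroupoid} (F F' : SmoothFunctor G H) where
  app : G.Obj → H.Arr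
  smooth_app : Mfd.Smooth app
  src_app : ∀ x, H.src (app x) = F.obj x
  tgt_app : ∀ x, H.tgt (app x) = F'.obj x
  naturality : ∀ g,
    H.comp (app (G.tgt g)) (F.arr g) ((src_app _).trans (F.tgt_arr g).symm) =
      H.comp (F'.arr g) (app (G.src g)) ((F'.src_arr g).trans (tgt_app _).symm)

namespace SmoothNatTrans

variable {G H K : LieGroupoid}

/-- The identity transformation. -/
def refl (F : SmoothFunctor G H) : SmoothNatTrans F F where
  app x := H.unit (F.obj x)
  smooth_app := H.smooth_unit.comp F.smooth_obj
  src_app x := H.src_unit _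
  tgt_app x := H.tgt_unit _
  naturality g := by
    have h1 := H.unit_comp (F.arr g)
    have h2 := H.comp_unit (F.arr g)
    exact (H.comp_congr (by rw [F.tgt_arr]) rfl _ _).trans
      (h1.trans (h2.symm.trans (H.comp_congr rfl (by rw [F.src_arr]) _ _)))

/-- Vertical composition. -/
def trans {F F' F'' : SmoothFunctor G H} (α : SmoothNatTrans F F') (β : SmoothNatTrans F' F'') :
    SmoothNatTrans F F'' where
  app x := H.comp (β.app x) (α.app x) ((β.src_app x).trans (α.tgt_app x).symm)
  smooth_app := H.smooth_comp' β.smooth_app α.smooth_app _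
  src_app x := by rw [H.src_comp, α.src_app]
  tgt_app x := by rw [H.tgt_comp, β.tgt_app]
  naturality g := by
    have hα := α.naturality g
    have hβ := β.naturality g
    rw [H.assoc _ _ _ _ ((α.src_app _).trans (F.tgt_arr g).symm)]
    rw [H.comp_congr rfl hα _ (by rw [H.tgt_comp, β.src_app, F'.tgt_arr])]
    rw [← H.assoc _ _ _ ((β.src_app _).trans (F'.tgt_arr g).symm)
      ((F'.src_arr g).trans (α.tgt_app _).symm)]
    rw [H.comp_congr hβ rfl _ (by rw [H.src_comp, β.src_app, α.tgt_app])]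
    rw [H.assoc _ _ _ ((F''.src_arr g).trans (β.tgt_app _).symm)
      ((β.src_app _).trans (α.tgt_app _).symm)]

/-- The inverse transformation. -/
def symm {F F' : SmoothFunctor G H} (α : SmoothNatTrans F F') : SmoothNatTrans F' F where
  app x := H.inv (α.app x)
  smooth_app := H.smooth_inv.comp α.smooth_app
  src_app x := by rw [H.src_inv, α.tgt_app]
  tgt_app x := by rw [H.tgt_inv, α.src_app]
  naturality g := by
    have hα := α.naturality g
    set x := G.src g
    set y := G.tgt g
    have e1 : H.src (F'.arr g) = H.tgt (α.app x) := (F'.src_arr g).trans (α.tgt_app _).symm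
    have e2 : H.src (α.app y) = H.tgt (F.arr g) := (α.src_app _).trans (F.tgt_arr g).symm
    have e3 : H.src (H.inv (α.app y)) = H.tgt (F'.arr g) := by
      rw [H.src_inv, α.tgt_app, F'.tgt_arr]
    have e4 : H.src (F.arr g) = H.tgt (H.inv (α.app x)) := by
      rw [H.tgt_inv, α.src_app, F.src_arr]
    have e5 : H.src (H.inv (α.app y)) = H.tgt (α.app y) := H.src_inv _
    calc H.comp (H.inv (α.app y)) (F'.arr g) e3
        = H.comp (H.inv (α.app y)) (H.comp (H.comp (F'.arr g) (α.app x) e1) (H.inv (α.app x))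
            (by rw [H.src_comp, H.tgt_inv])) (by rw [H.tgt_comp, H.tgt_comp, e3]) := by
          refine H.comp_congr rfl ?_ _ _
          rw [H.assoc _ _ _ e1 (H.tgt_inv _).symm,
            H.comp_congr rfl (H.comp_inv _) _ (by rw [H.tgt_unit, e1]),
            H.comp_congr rfl (congrArg H.unit e1.symm) _ (H.tgt_unit _).symm, H.comp_unit]
      _ = H.comp (H.inv (α.app y)) (H.comp (H.comp (α.app y) (F.arr g) e2) (H.inv (α.app x))
            (by rw [H.src_comp, e4])) (by rw [H.tgt_comp, H.tgt_comp, e5]) :=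
          H.comp_congr rfl (H.comp_congr hα.symm rfl _ _) _ _
      _ = H.comp (H.comp (H.inv (α.app y)) (H.comp (α.app y) (F.arr g) e2)
            (by rw [H.tgt_comp, e5])) (H.inv (α.app x)) (by rw [H.src_comp, H.src_comp, e4]) :=
          (H.assoc _ _ _ _ _).symm
      _ = H.comp (F.arr g) (H.inv (α.app x)) e4 := by
          refine H.comp_congr ?_ rfl _ _
          rw [← H.assoc _ _ _ e5 e2, H.comp_congr (H.inv_comp _) rfl _ (by rw [H.src_unit, e2]),
            H.comp_congr (congrArg H.unit e2) rfl _ (H.src_unit _), H.unit_comp]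

/-- Whiskering with a functor on the right. -/
def whiskerRight {F F' : SmoothFunctor G H} (α : SmoothNatTrans F F') (Q : SmoothFunctor H K) :
    SmoothNatTrans (F.comp Q) (F'.comp Q) where
  app x := Q.arr (α.app x)
  smooth_app := Q.smooth_arr.comp α.smooth_app
  src_app x := by rw [Q.src_arr, α.src_app]; rfl
  tgt_app x := by rw [Q.tgt_arr, α.tgt_app]; rfl
  naturality g := by
    have h := congrArg Q.arr (α.naturality g)
    rw [Q.arr_comp, Q.arr_comp] at h
    exact h

/-- Whiskering with a functor on the left. -/
def whiskerLeft (Q : SmoothFunctor G H) {F F' : SmoothFunctor H K} (α : SmoothNatTrans F F') :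
    SmoothNatTrans (Q.comp F) (Q.comp F') where
  app x := α.app (Q.obj x)
  smooth_app := α.smooth_app.comp Q.smooth_obj
  src_app x := α.src_app _
  tgt_app x := α.tgt_app _
  naturality g := by
    have h := α.naturality (Q.arr g)
    exact (K.comp_congr (by rw [Q.tgt_arr]) rfl _ _).trans
      (h.trans (K.comp_congr rfl (by rw [Q.src_arr]) _ _))

end SmoothNatTrans

/-- Two smooth functors are isomorphic if there is a smooth natural transformation between them. -/
instance functorSetoid (G H : LieGroupoid) : Setoid (SmoothFunctor G H) where
  r F F' := Nonempty (SmoothNatTrans F F')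
  iseqv := ⟨fun F => ⟨.refl F⟩, fun ⟨α⟩ => ⟨α.symm⟩, fun ⟨α⟩ ⟨β⟩ => ⟨α.trans β⟩⟩

/-- The category `Gp` of Lie groupoids and isomorphism classes of smooth functors. -/
instance category : Category LieGroupoid where
  Hom G H := Quotient (functorSetoid G H)
  id G := Quotient.mk _ (SmoothFunctor.id G)
  comp f g := Quotient.map₂ SmoothFunctor.comp (by
    rintro _ F' ⟨α⟩ Q _ ⟨β⟩
    exact ⟨(α.whiskerRight Q).trans (β.whiskerLeft F')⟩) f g
  id_comp f := by
    induction f using Quotient.inductionOn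
    rfl
  comp_id f := by
    induction f using Quotient.inductionOn
    rfl
  assoc f g h := by
    induction f using Quotient.inductionOn
    induction g using Quotient.inductionOn
    induction h using Quotient.inductionOn
    rfl

/-- The morphism `[F]` of `Gp` given by a smooth functor `F`. -/
def SmoothFunctor.cls {G H : LieGroupoid} (F : SmoothFunctor G H) : G ⟶ H :=
  Quotient.mk (functorSetoid G H) F

/-- A smooth functor `F : G → H` is an equivalence of Lie groupoids if
* the map `G₁ → (G₀ × G₀) ×_{H₀ × H₀} H₁`, `γ ↦ (s γ, t γ, F γ)` is a diffeomorphism, and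
* the map `G₀ ×_{F, H₀, t} H₁ → H₀`, `(x, h) ↦ s h` is a surjective submersion. -/
structure SmoothFunctor.IsEquivalence {G H : LieGroupoid} (F : SmoothFunctor G H) : Prop where
  arrows : IsFiberProduct ((𝓡 G.Obj.dim).prod (𝓡 G.Obj.dim)) (𝓡 H.Arr.dim)
    (fun x : G.Obj × G.Obj => (F.obj x.1, F.obj x.2)) (fun h : H.Arr => (H.src h, H.tgt h))
    (fun γ : G.Arr => (G.src γ, G.tgt γ)) F.arr
  objects : ∃ (P : Mfd) (p : P → G.Obj) (q : P → H.Arr),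
    IsFiberProduct (𝓡 G.Obj.dim) (𝓡 H.Arr.dim) F.obj H.tgt p q ∧
      Mfd.Submersion (fun x => H.src (q x)) ∧ Function.Surjective (fun x => H.src (q x))

/-- The class `W` of the isomorphism classes of equivalences. -/
def equivalences : MorphismProperty LieGroupoid :=
  fun G H f => ∃ F : SmoothFunctor G H, F.IsEquivalence ∧ F.cls = f

/-- A manifold `M` as the Lie groupoid `{M ⇉ M}`, all of whose arrows are identities. -/
def ofManifold (M : Mfd) : LieGroupoid where
  Obj := M
  Arr := M
  src x := x
  tgt x := x
  unit x := x
  inv x := x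
  comp x _ _ := x
  src_unit _ := rfl
  tgt_unit _ := rfl
  src_inv _ := rfl
  tgt_inv _ := rfl
  src_comp _ _ e := e
  tgt_comp _ _ _ := rfl
  unit_comp _ := rfl
  comp_unit _ := rfl
  inv_comp _ := rfl
  comp_inv _ := rfl
  assoc _ _ _ _ _ := rfl
  submersion_src := Manifold.IsSubmersion.id
  submersion_tgt := Manifold.IsSubmersion.id
  smooth_unit := contMDiff_id
  smooth_inv := contMDiff_id
  smooth_comp _ hm := contMDiff_fst.contMDiffOn.congr (fun p hp => hm p.1 p.2 hp)

/-- The smooth functor `{M ⇉ M} → {N ⇉ N}` given by a smooth map `M → N`. -/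
def ofMap {M N : Mfd} (f : M → N) (hf : Mfd.Smooth f) :
    SmoothFunctor (ofManifold M) (ofManifold N) where
  obj := f
  arr := f
  smooth_obj := hf
  smooth_arr := hf
  src_arr _ := rfl
  tgt_arr _ := rfl
  arr_unit _ := rfl
  arr_comp _ _ _ := rfl

theorem submersion_discrete {X Y : Type}
    (f : Mfd.discrete X → Mfd.discrete Y) : Mfd.Submersion f := by
  refine Manifold.IsSubmersionOfComplement.isSubmersion (F := PUnit.{1}) (fun x => ?_)
  refine Manifold.IsSubmersionAtOfComplement.mk_of_continuousAt
    (continuous_of_discreteTopology.continuousAt)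
    (ContinuousLinearEquiv.prodUnique ℝ (EuclideanSpace ℝ (Fin 0)) PUnit).symm
    (chartAt _ x) (chartAt _ (f x)) (mem_chart_source _ x) (mem_chart_source _ (f x))
    (IsManifold.chart_mem_maximalAtlas x) (IsManifold.chart_mem_maximalAtlas (f x)) ?_
  intro y _
  exact Subsingleton.elim (α := EuclideanSpace ℝ (Fin 0)) _ _

/-- The Lie groupoid `{Γ ⇉ *}` of a discrete group `Γ`. -/
def ofDiscreteGroup (Γ : Type) [Group Γ] : LieGroupoid where
  Obj := Mfd.discrete Unit
  Arr := Mfd.discrete Γ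
  src _ := ()
  tgt _ := ()
  unit _ := (1 : Γ)
  inv := (Inv.inv : Γ → Γ)
  comp := fun (g h : Γ) _ => (g * h : Γ)
  src_unit _ := rfl
  tgt_unit _ := rfl
  src_inv _ := rfl
  tgt_inv _ := rfl
  src_comp _ _ _ := rfl
  tgt_comp _ _ _ := rfl
  unit_comp := fun g : Γ => one_mul g
  comp_unit := fun g : Γ => mul_one g
  inv_comp := fun g : Γ => inv_mul_cancel g
  comp_inv := fun g : Γ => mul_inv_cancel g
  assoc := fun (g h k : Γ) _ _ => mul_assoc g h k
  submersion_src := submersion_discrete _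
  submersion_tgt := submersion_discrete _
  smooth_unit := contMDiff_const
  smooth_inv := contMDiff_of_discreteTopology
  smooth_comp _ _ := contMDiff_of_discreteTopology.contMDiffOn

/-- The Lie groupoid `{ℤ/2 ⇉ *}`. -/
def BZ2 : LieGroupoid := ofDiscreteGroup (Multiplicative (ZMod 2))

instance : IsManifold (𝓡 1) ∞ Circle := IsManifold.of_le (n := ω) le_top

/-- The circle as a Lie groupoid. -/
noncomputable def circle : LieGroupoid := ofManifold (Mfd.of Circle 1)

/-- An open subset of the circle as a Lie groupoid. -/
noncomputable def circleOpen (U : Opens Circle) : LieGroupoid := ofManifold (Mfd.of U 1)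

/-- The inclusion of an open subset of the circle, as a morphism of `Gp`. Restriction of a map on
the circle to `U` is precomposition with it. -/
noncomputable def inclusion (U : Opens Circle) : circleOpen U ⟶ circle :=
  (ofMap (M := Mfd.of U 1) (N := Mfd.of Circle 1) Subtype.val contMDiff_subtype_val).cls

end LieGroupoid

/-!
The two morphisms classify the trivial and the non-trivial double cover of the circle. The first is the
image of the constant functor `S¹ → {ℤ/2 ⇉ *}`. For the second, let `X` be the groupoid of the antipodal
action of `ℤ/2` on the circle. The map `z ↦ z²` defines an equivalence `p : X → S¹`, and recording the
acting group element defines a functor `q : X → {ℤ/2 ⇉ *}`; the second morphism is `L(q) ∘ L(p)⁻¹`.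
On the circle minus a point there is a smooth square root, which gives a functor `σ` to `X` with
`p ∘ σ` the inclusion and `q ∘ σ` constant. So the two morphisms agree on the complements of `-1` and of
`1`, which cover the circle.

They are distinct if `L(q) ≠ L(c ∘ p)`, where `c` is the constant functor on the circle. This is
detected by any functor on `Gp` that inverts the equivalences and separates `q` from `c ∘ p`. Such a
functor is the first cohomology set `LieGroupoid.H1` with coefficients in `ℤ/2`, for a model of cocycles
in which pullback is plain composition: an arbitrary (discontinuous) additive function on the arrows,
with the germs of functions on the objects that make it continuous. Invariance under an equivalence
`F : G → H` (`LieGroupoid.H1.isInvertedBy`) rests on two facts: arrows of `H` lift uniquely and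
continuously to `G` once the end points have been chosen, and near each object of `H` these choices can
be made continuously, since submersions have local sections. The cocycles of `q` and of `c ∘ p` are not
cohomologous because a continuous function `b` from the circle to `ℤ/2` with `b(-z) = b(z) - 1` does not
exist, the circle being connected (`LieGroupoid.H1_doubleCover_ne`).

That `p` is an equivalence comes down to two facts: `z ↦ z²` is a local diffeomorphism, and a pair
`(i, f)` of an immersion `i` and a smooth map `f` is an immersion
(`Manifold.IsImmersionOfComplement.prodMk`).
-/

open scoped Topology

/-! ### Local sections of submersions -/

/-- A submersion has, through each point of its domain, a local section that is continuous there. -/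
theorem Mfd.Submersion.exists_section {M N : Mfd} {f : M → N} (hf : Mfd.Submersion f) (x : M) :
    ∃ s : N → M, s (f x) = x ∧ ContinuousAt s (f x) ∧ ∀ᶠ z in 𝓝 (f x), f (s z) = z := by
  have h := hf.isSubmersionOfComplement_complement x
  -- in the adapted charts `f` is `(u, v) ↦ u`; the section is `u ↦ (u, v₀)`
  set φ := h.domChart
  set ψ := h.codChart
  set e := h.equiv
  have hx : x ∈ φ.source := h.mem_domChart_source
  have hfx : f x ∈ ψ.source := h.mem_codChart_source
  have key : ∀ y ∈ φ.target, ψ (f (φ.symm y)) = (e y).1 := fun y hy => by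
    simpa using h.writtenInCharts (show y ∈ (φ.extend (𝓡 M.dim)).target by simpa using hy)
  let k : EuclideanSpace ℝ (Fin N.dim) → EuclideanSpace ℝ (Fin M.dim) :=
    fun u => e.symm (u, (e (φ x)).2)
  have hkc : Continuous k := e.symm.continuous.comp (by fun_prop)
  have hk0 : k (ψ (f x)) = φ x := by
    have := key (φ x) (φ.map_source hx)
    rw [φ.left_inv hx] at this
    simp only [k, this, e.symm_apply_apply]
  have hkψ : ContinuousAt (fun z => k (ψ z)) (f x) :=
    hkc.continuousAt.comp (ψ.continuousAt hfx)
  have hmem : ∀ᶠ z in 𝓝 (f x), k (ψ z) ∈ φ.target :=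
    hkψ.eventually_mem (φ.open_target.mem_nhds (by rw [hk0]; exact φ.map_source hx))
  refine ⟨fun z => φ.symm (k (ψ z)), ?_, ?_, ?_⟩
  · simp only [hk0, φ.left_inv hx]
  · refine ContinuousAt.comp (g := φ.symm) ?_ hkψ
    rw [hk0]
    exact φ.symm.continuousAt (φ.map_source hx)
  · filter_upwards [hmem, ψ.open_source.mem_nhds hfx] with z hz hzs
    have h1 : ψ (f (φ.symm (k (ψ z)))) = ψ z := by rw [key _ hz]; simp [k]
    exact ψ.injOn (h.mapsto_domChart_source_codChart_source (φ.map_target hz)) hzs h1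

namespace LieGroupoid

/-! ### Composition of arrows as a total operation -/

section Mul

variable (G : LieGroupoid)

open Classical in
/-- The composite of two arrows, extended by the junk value `g` to pairs that are not composable. -/
noncomputable def mul (g h : G.Arr) : G.Arr := if e : G.src g = G.tgt h then G.comp g h e else g

variable {G}

theorem mul_eq {g h : G.Arr} (e : G.src g = G.tgt h) : G.mul g h = G.comp g h e := dif_pos e

theorem src_mul {g h : G.Arr} (e : G.src g = G.tgt h) : G.src (G.mul g h) = G.src h := by
  rw [mul_eq e, G.src_comp]

theorem tgt_mul {g h : G.Arr} (e : G.src g = G.tgt h) : G.tgt (G.mul g h) = G.tgt g := by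
  rw [mul_eq e, G.tgt_comp]

theorem mul_unit {g : G.Arr} {x : G.Obj} (e : G.src g = x) : G.mul g (G.unit x) = g := by
  subst e
  rw [mul_eq (G.tgt_unit _).symm, G.comp_unit]

theorem unit_mul {g : G.Arr} {x : G.Obj} (e : G.tgt g = x) : G.mul (G.unit x) g = g := by
  subst e
  rw [mul_eq (G.src_unit _), G.unit_comp]

theorem mul_inv (g : G.Arr) : G.mul g (G.inv g) = G.unit (G.tgt g) := by
  rw [mul_eq (G.tgt_inv g).symm, G.comp_inv]

theorem inv_mul (g : G.Arr) : G.mul (G.inv g) g = G.unit (G.src g) := by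
  rw [mul_eq (G.src_inv g), G.inv_comp]

theorem mul_assoc {g h k : G.Arr} (e : G.src g = G.tgt h) (e' : G.src h = G.tgt k) :
    G.mul (G.mul g h) k = G.mul g (G.mul h k) := by
  have h1 : G.src (G.comp g h e) = G.tgt k := (G.src_comp g h e).trans e'
  have h2 : G.src g = G.tgt (G.comp h k e') := e.trans (G.tgt_comp h k e').symm
  rw [mul_eq e, mul_eq e', mul_eq h1, mul_eq h2, G.assoc]

theorem mul_inv_cancel_right {g h : G.Arr} (e : G.src g = G.tgt h) :
    G.mul (G.mul g h) (G.inv h) = g := by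
  rw [mul_assoc e (G.tgt_inv h).symm, mul_inv, mul_unit e]

theorem inv_mul_cancel_right {g h : G.Arr} (e : G.src g = G.src h) :
    G.mul (G.mul g (G.inv h)) h = g := by
  rw [mul_assoc (e.trans (G.tgt_inv h).symm) (G.src_inv h), inv_mul, mul_unit e]

theorem continuousAt_mul {X : Type*} [TopologicalSpace X] {a b : X → G.Arr} {x : X}
    (ha : ContinuousAt a x) (hb : ContinuousAt b x) (e : ∀ᶠ y in 𝓝 x, G.src (a y) = G.tgt (b y)) :
    ContinuousAt (fun y => G.mul (a y) (b y)) x := by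
  have h := (G.smooth_comp G.mul (fun _ _ e => mul_eq e)).continuousOn (a x, b x) e.self_of_nhds
  exact h.tendsto.comp (tendsto_nhdsWithin_iff.2 ⟨ha.prodMk_nhds hb, e⟩)

variable (G) in
theorem continuous_src : Continuous G.src := G.submersion_src.contMDiff.continuous

variable (G) in
theorem continuous_tgt : Continuous G.tgt := G.submersion_tgt.contMDiff.continuous

theorem SmoothFunctor.arr_mul {H : LieGroupoid} (F : SmoothFunctor G H) {g h : G.Arr}
    (e : G.src g = G.tgt h) : F.arr (G.mul g h) = H.mul (F.arr g) (F.arr h) := by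
  rw [mul_eq e, F.arr_comp, mul_eq]

end Mul

/-! ### Lifting arrows along an equivalence -/

section Lift

variable {G H : LieGroupoid} {F : SmoothFunctor G H}

namespace SmoothFunctor

/-- The arrow `γ : x → x'` of `G` is a lift of the arrow `l` of `H` along `k : s(l) → F(x)` and
`k' : t(l) → F(x')` if `F(γ) ∘ k = k' ∘ l`. -/
structure IsLift (F : SmoothFunctor G H) (x : G.Obj) (k : H.Arr) (x' : G.Obj) (k' l : H.Arr)
    (γ : G.Arr) : Prop where
  src_eq : G.src γ = x
  tgt_eq : G.tgt γ = x'
  src_left : H.src k = H.src l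
  tgt_left : H.tgt k = F.obj x
  src_right : H.src k' = H.tgt l
  tgt_right : H.tgt k' = F.obj x'
  comm : H.mul (F.arr γ) k = H.mul k' l

namespace IsLift

variable {x x' x'' : G.Obj} {k k' k'' l m : H.Arr} {γ δ : G.Arr}

theorem src_arr_eq (h : F.IsLift x k x' k' l γ) : H.src (F.arr γ) = H.tgt k := by
  rw [F.src_arr, h.src_eq, h.tgt_left]

theorem arr_eq (h : F.IsLift x k x' k' l γ) : F.arr γ = H.mul (H.mul k' l) (H.inv k) := by
  rw [← h.comm, mul_inv_cancel_right h.src_arr_eq]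

/-- Lifts can be composed. -/
theorem mul (h : F.IsLift x k x' k' l γ) (h' : F.IsLift x' k' x'' k'' m δ) :
    F.IsLift x k x'' k'' (H.mul m l) (G.mul δ γ) := by
  have e : G.src δ = G.tgt γ := by rw [h'.src_eq, h.tgt_eq]
  have eH : H.src (F.arr δ) = H.tgt (F.arr γ) := by rw [F.src_arr, F.tgt_arr, e]
  have e2 : H.src m = H.tgt l := by rw [← h'.src_left, h.src_right]
  refine ⟨by rw [src_mul e, h.src_eq], by rw [tgt_mul e, h'.tgt_eq], by rw [src_mul e2, h.src_left],
    h.tgt_left, by rw [tgt_mul e2, h'.src_right], h'.tgt_right, ?_⟩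
  rw [F.arr_mul e, mul_assoc eH h.src_arr_eq, h.comm,
    ← mul_assoc (by rw [F.src_arr, h'.src_eq, h'.tgt_left]) h.src_right, h'.comm,
    mul_assoc h'.src_right e2]

end IsLift

namespace IsEquivalence

variable (hF : F.IsEquivalence)
include hF

theorem arr_ext {γ δ : G.Arr} (hs : G.src γ = G.src δ) (ht : G.tgt γ = G.tgt δ)
    (h : F.arr γ = F.arr δ) : γ = δ :=
  hF.arrows.1.isEmbedding.injective (by simp only [hs, ht, h])

theorem exists_arr {x x' : G.Obj} {h : H.Arr} (hs : H.src h = F.obj x) (ht : H.tgt h = F.obj x') :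
    ∃ γ, G.src γ = x ∧ G.tgt γ = x' ∧ F.arr γ = h := by
  have : ((x, x'), h) ∈ {z : (G.Obj × G.Obj) × H.Arr |
      (F.obj z.1.1, F.obj z.1.2) = (H.src z.2, H.tgt z.2)} := by
    simp [hs, ht]
  rw [← hF.arrows.2] at this
  obtain ⟨γ, hγ⟩ := this
  simp only [Prod.mk.injEq] at hγ
  exact ⟨γ, hγ.1.1, hγ.1.2, hγ.2⟩

theorem continuousAt_arr {X : Type*} [TopologicalSpace X] {a : X → G.Arr} {x : X}
    (hs : ContinuousAt (fun y => G.src (a y)) x) (ht : ContinuousAt (fun y => G.tgt (a y)) x)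
    (h : ContinuousAt (fun y => F.arr (a y)) x) : ContinuousAt a x :=
  hF.arrows.1.isEmbedding.isInducing.continuousAt_iff.2 ((hs.prodMk hs |>.fst.prodMk ht).prodMk h)

theorem exists_isLift {x x' : G.Obj} {k k' l : H.Arr} (h1 : H.src k = H.src l)
    (h2 : H.tgt k = F.obj x) (h3 : H.src k' = H.tgt l) (h4 : H.tgt k' = F.obj x') :
    ∃ γ, F.IsLift x k x' k' l γ := by
  have e : H.src (H.mul k' l) = H.tgt (H.inv k) := by rw [src_mul h3, H.tgt_inv, h1]
  obtain ⟨γ, hs, ht, hγ⟩ := hF.exists_arr (x := x) (x' := x')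
    (h := H.mul (H.mul k' l) (H.inv k)) (by rw [src_mul e, H.src_inv, h2])
    (by rw [tgt_mul e, tgt_mul h3, h4])
  refine ⟨γ, hs, ht, h1, h2, h3, h4, ?_⟩
  rw [hγ, inv_mul_cancel_right (by rw [src_mul h3, h1])]

theorem isLift_unique {x x' : G.Obj} {k k' l : H.Arr} {γ δ : G.Arr}
    (h : F.IsLift x k x' k' l γ) (h' : F.IsLift x k x' k' l δ) : γ = δ :=
  hF.arr_ext (h.src_eq.trans h'.src_eq.symm) (h.tgt_eq.trans h'.tgt_eq.symm)
    (h.arr_eq.trans h'.arr_eq.symm)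

/-- Lifts depend continuously on the data. -/
theorem continuousAt_of_isLift {X : Type*} [TopologicalSpace X] {x x' : X → G.Obj}
    {k k' l : X → H.Arr} {γ : X → G.Arr} {a : X}
    (h : ∀ᶠ b in 𝓝 a, F.IsLift (x b) (k b) (x' b) (k' b) (l b) (γ b)) (hx : ContinuousAt x a)
    (hk : ContinuousAt k a) (hx' : ContinuousAt x' a) (hk' : ContinuousAt k' a)
    (hl : ContinuousAt l a) : ContinuousAt γ a := by
  refine hF.continuousAt_arr (hx.congr ?_) (hx'.congr ?_) (ContinuousAt.congr
    (f := fun b => H.mul (H.mul (k' b) (l b)) (H.inv (k b))) ?_ ?_)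
  · filter_upwards [h] with b hb using hb.src_eq.symm
  · filter_upwards [h] with b hb using hb.tgt_eq.symm
  · refine continuousAt_mul (continuousAt_mul hk' hl ?_)
      (H.smooth_inv.continuous.continuousAt.comp hk) ?_
    · filter_upwards [h] with b hb using hb.src_right
    · filter_upwards [h] with b hb
      rw [src_mul hb.src_right, H.tgt_inv, hb.src_left]
  · filter_upwards [h] with b hb using hb.arr_eq.symm

/-- Near each object of `H`, arrows to objects in the image of `F` can be chosen continuously. -/
theorem exists_local (y : H.Obj) : ∃ (σ : H.Obj → G.Obj) (h : H.Obj → H.Arr),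
    ContinuousAt σ y ∧ ContinuousAt h y ∧
      ∀ᶠ z in 𝓝 y, H.src (h z) = z ∧ H.tgt (h z) = F.obj (σ z) := by
  obtain ⟨P, p, q, hP, hsub, hsurj⟩ := hF.objects
  obtain ⟨w, rfl⟩ := hsurj y
  obtain ⟨s, -, hs, hsec⟩ := hsub.exists_section w
  have hcont := hP.1.isEmbedding.continuous
  refine ⟨fun z => p (s z), fun z => q (s z), (continuous_fst.comp hcont).continuousAt.comp hs,
    (continuous_snd.comp hcont).continuousAt.comp hs, hsec.mono fun z hz => ⟨hz, ?_⟩⟩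
  exact (hP.2.subset (mem_range_self (s z))).symm

end IsEquivalence

end SmoothFunctor

end Lift

/-! ### First cohomology of Lie groupoids -/

section Cocycle

variable (A : Type) [AddCommGroup A] [TopologicalSpace A]

/-- An `A`-valued cocycle on a Lie groupoid `G`, for a topological abelian group `A`. It encodes a
principal `A`-bundle on `G` in which a point of each fiber has been chosen, with no continuity in the
object. Relative to these choices the arrows of `G` act by a functor `val` to `A`, and the topology of
the bundle is recorded by functions `gauge x`, of which only the germ at `x` modulo functions
continuous at `x` matters: `y ↦ gauge x y` is a section that counts as continuous at `x`. No relation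
between `gauge x` and `gauge y` for `x` near `y` is imposed, so a cocycle is slightly more general than
a bundle; invariance under equivalences does not need it. -/
structure Cocycle (G : LieGroupoid) where
  val : G.Arr → A
  gauge : G.Obj → G.Obj → A
  val_mul : ∀ {g h}, G.src g = G.tgt h → val (G.mul g h) = val g + val h
  continuousAt : ∀ g, ContinuousAt
    (fun g' => val g' + gauge (G.src g) (G.src g') - gauge (G.tgt g) (G.tgt g')) g

variable {A}

/-- Two cocycles are cohomologous if they differ by a change `c` of the chosen points of the fibers,
which need not be continuous. -/
def Cohomologous {G : LieGroupoid} (φ ψ : Cocycle A G) : Prop :=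
  ∃ c : G.Obj → A, (∀ g, ψ.val g - φ.val g = c (G.tgt g) - c (G.src g)) ∧
    ∀ x, ContinuousAt (fun y => ψ.gauge x y - φ.gauge x y - c y) x

/-- The pullback of a cocycle along a smooth functor. -/
def Cocycle.pullback {G H : LieGroupoid} (F : SmoothFunctor G H) (φ : Cocycle A H) :
    Cocycle A G where
  val g := φ.val (F.arr g)
  gauge x y := φ.gauge (F.obj x) (F.obj y)
  val_mul e := by
    rw [F.arr_mul e, φ.val_mul (by rw [F.src_arr, F.tgt_arr, e])]
  continuousAt g := by
    have h := (φ.continuousAt (F.arr g)).comp (F.smooth_arr.continuous.continuousAt (x := g))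
    simpa only [Function.comp_def, F.src_arr, F.tgt_arr] using h

theorem Cohomologous.refl {G : LieGroupoid} (φ : Cocycle A G) : Cohomologous φ φ :=
  ⟨0, by simp, fun x => by simpa using continuousAt_const⟩

theorem Cohomologous.pullback {G H : LieGroupoid} (F : SmoothFunctor G H) {φ ψ : Cocycle A H} :
    Cohomologous φ ψ → Cohomologous (φ.pullback F) (ψ.pullback F) := by
  rintro ⟨c, hc, hc'⟩
  refine ⟨fun x => c (F.obj x), fun g => ?_, fun x =>
    (hc' (F.obj x)).comp (F.smooth_obj.continuous.continuousAt (x := x))⟩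
  simp only [Cocycle.pullback, hc, F.src_arr, F.tgt_arr]

variable [IsTopologicalAddGroup A]

theorem Cohomologous.symm {G : LieGroupoid} {φ ψ : Cocycle A G} :
    Cohomologous φ ψ → Cohomologous ψ φ := by
  rintro ⟨c, hc, hc'⟩
  refine ⟨-c, fun g => ?_, fun x => (hc' x).neg.congr (.of_forall fun y => ?_)⟩
  · rw [← neg_sub, hc]
    simp only [Pi.neg_apply]
    abel
  · simp only [Pi.neg_apply]
    abel

theorem Cohomologous.trans {G : LieGroupoid} {φ ψ χ : Cocycle A G} :
    Cohomologous φ ψ → Cohomologous ψ χ → Cohomologous φ χ := by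
  rintro ⟨c, hc, hc'⟩ ⟨d, hd, hd'⟩
  refine ⟨c + d, fun g => ?_, fun x => ((hc' x).add (hd' x)).congr (.of_forall fun y => ?_)⟩
  · rw [← sub_add_sub_cancel (χ.val g) (ψ.val g), hc, hd]
    simp only [Pi.add_apply]
    abel
  · simp only [Pi.add_apply]
    abel

/-- Pullbacks along isomorphic functors are cohomologous. -/
theorem Cocycle.pullback_cohomologous {G H : LieGroupoid} {F F' : SmoothFunctor G H}
    (α : SmoothNatTrans F F') (φ : Cocycle A H) :
    Cohomologous (φ.pullback F) (φ.pullback F') := by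
  refine ⟨fun x => φ.val (α.app x), fun g => ?_, fun x => ?_⟩
  · have h := congrArg φ.val (α.naturality g)
    rw [← mul_eq, ← mul_eq, φ.val_mul ((α.src_app _).trans (F.tgt_arr g).symm),
      φ.val_mul ((F'.src_arr g).trans (α.tgt_app _).symm)] at h
    simp only [pullback]
    rw [sub_eq_sub_iff_add_eq_add, ← h, add_comm]
  · have h := ((φ.continuousAt (α.app x)).comp
      (α.smooth_app.continuous.continuousAt (x := x))).neg
    refine h.congr (.of_forall fun y => ?_)
    simp only [pullback, Function.comp, Pi.neg_apply, α.src_app, α.tgt_app]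
    abel

variable (A) in
/-- The equivalence relation of being cohomologous. -/
def cocycleSetoid (G : LieGroupoid) : Setoid (Cocycle A G) where
  r := Cohomologous
  iseqv := ⟨.refl, .symm, .trans⟩

variable (A) in
/-- The first cohomology set: cocycles up to cohomology. It contains the usual `H¹(G, A)`, the set of
isomorphism classes of principal `A`-bundles. -/
def H1 (G : LieGroupoid) : Type := Quotient (cocycleSetoid A G)

variable (A) in
/-- The map induced on first cohomology by a morphism of `Gp`. -/
def H1.map {G H : LieGroupoid} (f : G ⟶ H) : H1 A H → H1 A G :=
  Quotient.map₂ (sa := functorSetoid G H) (sb := cocycleSetoid A H) (sc := cocycleSetoid A G)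
    (fun F φ => φ.pullback F)
    (by rintro F F' ⟨α⟩ φ ψ h; exact (h.pullback F).trans (ψ.pullback_cohomologous α)) f

variable (A) in
/-- First cohomology as a contravariant functor on `Gp`. -/
def H1.functor : LieGroupoid ⥤ Typeᵒᵖ where
  obj G := .op (H1 A G)
  map f := Quiver.Hom.op (TypeCat.ofHom (H1.map A f))
  map_id G := by
    refine congrArg Quiver.Hom.op ?_
    ext x
    induction x using Quotient.inductionOn
    rfl
  map_comp f g := by
    refine congrArg Quiver.Hom.op ?_
    ext x
    induction f using Quotient.inductionOn
    induction g using Quotient.inductionOn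
    induction x using Quotient.inductionOn
    rfl

namespace SmoothFunctor.IsEquivalence

variable {G H : LieGroupoid} {F : SmoothFunctor G H} (hF : F.IsEquivalence)
include hF

/-- Pullback along an equivalence reflects the relation of being cohomologous. -/
theorem cohomologous_of_pullback {φ ψ : Cocycle A H}
    (hc : Cohomologous (φ.pullback F) (ψ.pullback F)) : Cohomologous φ ψ := by
  obtain ⟨c, hc, hc'⟩ := hc
  simp only [Cocycle.pullback] at hc hc'
  choose σ h hσ hh hloc using hF.exists_local
  -- `x y` is an object of `G` with an arrow `k y : y → F (x y)`
  let x := fun y => σ y y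
  let k := fun y => h y y
  have hk : ∀ y, H.src (k y) = y ∧ H.tgt (k y) = F.obj (x y) := fun y => (hloc y).self_of_nhds
  -- any lift computes the difference of the two cocycles
  have key : ∀ {z z' : G.Obj} {a a' l : H.Arr}, H.src a = H.src l → H.tgt a = F.obj z →
      H.src a' = H.tgt l → H.tgt a' = F.obj z' →
      (ψ.val l - φ.val l) + (ψ.val a' - φ.val a') - (ψ.val a - φ.val a) = c z' - c z := by
    intro z z' a a' l h1 h2 h3 h4
    obtain ⟨γ, hγ⟩ := hF.exists_isLift h1 h2 h3 h4
    have e1 := congrArg φ.val hγ.comm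
    have e2 := congrArg ψ.val hγ.comm
    rw [φ.val_mul hγ.src_arr_eq, φ.val_mul h3] at e1
    rw [ψ.val_mul hγ.src_arr_eq, ψ.val_mul h3] at e2
    rw [← hγ.src_eq, ← hγ.tgt_eq, ← hc]
    rw [eq_sub_of_add_eq e1, eq_sub_of_add_eq e2]
    abel
  refine ⟨fun y => c (x y) - (ψ.val (k y) - φ.val (k y)), fun l => ?_, fun y => ?_⟩
  · beta_reduce
    rw [← sub_eq_zero, ← sub_eq_zero.2 (key (l := l) (hk _).1 (hk _).2 (hk _).1 (hk _).2)]
    abel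
  · have c1 : ContinuousAt (fun z => (ψ.val (h y z) + ψ.gauge y z - ψ.gauge (F.obj (σ y y))
        (F.obj (σ y z))) - (φ.val (h y z) + φ.gauge y z - φ.gauge (F.obj (σ y y))
        (F.obj (σ y z)))) y := by
      refine (((ψ.continuousAt (h y y)).comp (hh y)).sub
        ((φ.continuousAt (h y y)).comp (hh y))).congr ?_
      filter_upwards [hloc y] with z hz
      have hy : H.src (h y y) = y ∧ H.tgt (h y y) = F.obj (σ y y) := hk y
      simp only [Pi.sub_apply, Function.comp, hz, hy]
    have c2 := (hc' (σ y y)).comp (hσ y)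
    refine (c1.add c2).congr ?_
    filter_upwards [hloc y] with z hz
    have e := key (l := H.unit z) (a := k z) (a' := h y z) (by rw [H.src_unit, (hk z).1]) (hk z).2
      (by rw [H.tgt_unit, hz.1]) hz.2
    have e0 : ∀ χ : Cocycle A H, χ.val (H.unit z) = 0 := fun χ => by
      have := χ.val_mul (g := H.unit z) (h := H.unit z) (by rw [H.src_unit, H.tgt_unit])
      rwa [mul_unit (H.src_unit z), left_eq_add] at this
    rw [e0, e0] at e
    simp only [Pi.add_apply, Function.comp]
    rw [← sub_eq_zero, ← sub_eq_zero.2 e]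
    abel

/-- Every cocycle descends along an equivalence, up to cohomology: `val` is transported along lifts to
chosen objects of `G`, and the gauge at `y` uses objects of `G` that vary continuously near `y`. -/
theorem exists_pullback_cohomologous (φ : Cocycle A G) :
    ∃ ψ : Cocycle A H, Cohomologous φ (ψ.pullback F) := by
  choose σ h hσ hh hloc using hF.exists_local
  -- `x y` is an object of `G` with an arrow `k y : y → F (x y)`
  let x := fun y => σ y y
  let k := fun y => h y y
  have hk : ∀ y, H.src (k y) = y ∧ H.tgt (k y) = F.obj (x y) := fun y => (hloc y).self_of_nhds
  -- `γ l` is the lift of `l` to the chosen objects of `G`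
  choose γ hγ using fun l : H.Arr => hF.exists_isLift (l := l) (hk _).1 (hk _).2 (hk _).1 (hk _).2
  -- `δ y z : x z → σ y z` compares the chosen object with the one varying continuously near `y`
  have hδ' : ∀ y z, ∃ δ, (H.src (h y z) = z ∧ H.tgt (h y z) = F.obj (σ y z)) →
      F.IsLift (x z) (k z) (σ y z) (h y z) (H.unit z) δ := fun y z => by
    by_cases hz : H.src (h y z) = z ∧ H.tgt (h y z) = F.obj (σ y z)
    · obtain ⟨δ, hδ⟩ := hF.exists_isLift (l := H.unit z) (k := k z) (k' := h y z)
        (by rw [H.src_unit, (hk z).1]) (hk z).2 (by rw [H.tgt_unit, hz.1]) hz.2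
      exact ⟨δ, fun _ => hδ⟩
    · exact ⟨G.unit (x z), fun h => absurd h hz⟩
  choose δ hδ using hδ'
  -- by uniqueness of lifts, a commutative square in `H` lifts to a relation between values of `φ`
  have val_eq : ∀ {x x' x'' z' : G.Obj} {k k' k'' c' l m l' m' : H.Arr} {γ₁ γ₂ γ₃ γ₄ : G.Arr},
      F.IsLift x k x' k' l γ₁ → F.IsLift x' k' x'' k'' m γ₂ → F.IsLift x k z' c' l' γ₃ →
      F.IsLift z' c' x'' k'' m' γ₄ → H.mul m l = H.mul m' l' →
      φ.val γ₂ + φ.val γ₁ = φ.val γ₄ + φ.val γ₃ := by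
    intro _ _ _ _ _ _ _ _ _ _ _ _ _ _ _ _ h1 h2 h3 h4 e
    have h12 := h1.mul h2
    rw [e] at h12
    rw [← φ.val_mul (h2.src_eq.trans h1.tgt_eq.symm), ← φ.val_mul (h4.src_eq.trans h3.tgt_eq.symm),
      hF.isLift_unique h12 (h3.mul h4)]
  let ψ : Cocycle A H :=
    { val := fun l => φ.val (γ l)
      gauge := fun y z => φ.gauge (x y) (σ y z) - φ.val (δ y z)
      val_mul := by
        intro l m e
        have h2 := hγ l
        rw [e] at h2
        have h1 := hγ (H.mul l m)
        rw [src_mul e, tgt_mul e] at h1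
        rw [hF.isLift_unique h1 ((hγ m).mul h2), φ.val_mul (h2.src_eq.trans (hγ m).tgt_eq.symm)]
      continuousAt := by
        intro l
        -- `β l'` is the lift of `l'` to the objects varying continuously near the ends of `l`
        have ev1 := (H.continuous_src.continuousAt (x := l)).eventually (hloc (H.src l))
        have ev2 := (H.continuous_tgt.continuousAt (x := l)).eventually (hloc (H.tgt l))
        have hβ' : ∀ l', ∃ β, ((H.src (h (H.src l) (H.src l')) = H.src l' ∧
            H.tgt (h (H.src l) (H.src l')) = F.obj (σ (H.src l) (H.src l'))) ∧
            (H.src (h (H.tgt l) (H.tgt l')) = H.tgt l' ∧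
            H.tgt (h (H.tgt l) (H.tgt l')) = F.obj (σ (H.tgt l) (H.tgt l')))) →
            F.IsLift (σ (H.src l) (H.src l')) (h (H.src l) (H.src l')) (σ (H.tgt l) (H.tgt l'))
              (h (H.tgt l) (H.tgt l')) l' β := fun l' => by
          by_cases hz : ((H.src (h (H.src l) (H.src l')) = H.src l' ∧
            H.tgt (h (H.src l) (H.src l')) = F.obj (σ (H.src l) (H.src l'))) ∧
            (H.src (h (H.tgt l) (H.tgt l')) = H.tgt l' ∧
            H.tgt (h (H.tgt l) (H.tgt l')) = F.obj (σ (H.tgt l) (H.tgt l'))))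
          · obtain ⟨β, hβ⟩ := hF.exists_isLift hz.1.1 hz.1.2 hz.2.1 hz.2.2
            exact ⟨β, fun _ => hβ⟩
          · exact ⟨γ l, fun h => absurd h hz⟩
        choose β hβ using hβ'
        have ev : ∀ᶠ l' in 𝓝 l, F.IsLift (σ (H.src l) (H.src l')) (h (H.src l) (H.src l'))
            (σ (H.tgt l) (H.tgt l')) (h (H.tgt l) (H.tgt l')) l' (β l') := by
          filter_upwards [ev1, ev2] with l' h1 h2 using hβ l' ⟨h1, h2⟩
        have hcs : ContinuousAt H.src l := H.continuous_src.continuousAt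
        have hct : ContinuousAt H.tgt l := H.continuous_tgt.continuousAt
        have hβc : ContinuousAt β l := hF.continuousAt_of_isLift ev
          ((hσ _).comp hcs) ((hh _).comp hcs) ((hσ _).comp hct) ((hh _).comp hct) continuousAt_id
        refine ((φ.continuousAt (β l)).comp hβc).congr ?_
        filter_upwards [ev1, ev2, ev] with l' h1 h2 h3
        have e := val_eq (hδ _ _ h1) h3 (hγ l') (hδ _ _ h2)
          (by rw [mul_unit rfl, unit_mul rfl])
        simp only [Function.comp, h3.src_eq, h3.tgt_eq, ev.self_of_nhds.src_eq,
          ev.self_of_nhds.tgt_eq, eq_sub_of_add_eq e, x]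
        abel }
  -- `ε z : z → x (F z)` is the lift of `k (F z)`
  choose ε hε using fun z : G.Obj => hF.exists_isLift (x := z) (k := H.unit (F.obj z))
    (l := H.unit (F.obj z)) rfl (H.tgt_unit _) ((hk (F.obj z)).1.trans (H.tgt_unit _).symm)
    (hk (F.obj z)).2
  refine ⟨ψ, fun z => φ.val (ε z), fun g => ?_, fun z => ?_⟩
  · have hg : F.IsLift (G.src g) (H.unit (F.obj (G.src g))) (G.tgt g) (H.unit (F.obj (G.tgt g)))
        (F.arr g) g := by
      refine ⟨rfl, rfl, by rw [H.src_unit, F.src_arr], H.tgt_unit _, by rw [H.src_unit, F.tgt_arr],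
        H.tgt_unit _, ?_⟩
      rw [mul_unit (F.src_arr g), unit_mul (F.tgt_arr g)]
    have h2 := hγ (F.arr g)
    rw [F.src_arr, F.tgt_arr] at h2
    have e := val_eq (hε (G.src g)) h2 hg (hε (G.tgt g))
      (by rw [mul_unit (F.src_arr g), unit_mul (F.tgt_arr g)])
    change φ.val (γ (F.arr g)) - φ.val g = _
    rw [sub_eq_sub_iff_add_eq_add, e]
  · have hcF : ContinuousAt F.obj z := F.smooth_obj.continuous.continuousAt
    have ev1 := hcF.eventually (hloc (F.obj z))
    have ev : ∀ᶠ w in 𝓝 z, F.IsLift w (H.unit (F.obj w)) (σ (F.obj z) (F.obj w))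
        (h (F.obj z) (F.obj w)) (H.unit (F.obj w)) (G.mul (δ (F.obj z) (F.obj w)) (ε w)) := by
      filter_upwards [ev1] with w hw
      simpa only [mul_unit (H.src_unit _)] using (hε w).mul (hδ _ _ hw)
    have hu : ContinuousAt (fun w => H.unit (F.obj w)) z :=
      H.smooth_unit.continuous.continuousAt.comp hcF
    have hc := hF.continuousAt_of_isLift ev continuousAt_id hu ((hσ _).comp hcF)
      ((hh _).comp hcF) hu
    refine ((φ.continuousAt _).comp hc).neg.congr ?_
    filter_upwards [ev1, ev] with w hw hw'
    simp only [Function.comp, Pi.neg_apply, hw'.src_eq, hw'.tgt_eq, ev.self_of_nhds.src_eq,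
      ev.self_of_nhds.tgt_eq, φ.val_mul ((hδ _ _ hw).src_eq.trans (hε w).tgt_eq.symm)]
    change _ = φ.gauge (x (F.obj z)) (σ (F.obj z) (F.obj w)) - φ.val (δ (F.obj z) (F.obj w)) - _ - _
    simp only [x]
    abel

end SmoothFunctor.IsEquivalence

variable (A) in
/-- First cohomology is invariant under equivalences of Lie groupoids. -/
theorem H1.isInvertedBy : equivalences.IsInvertedBy (H1.functor A) := by
  rintro G H _ ⟨F, hF, rfl⟩
  suffices IsIso (TypeCat.ofHom (H1.map A F.cls)) from
    inferInstanceAs (IsIso (TypeCat.ofHom (H1.map A F.cls)).op)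
  rw [isIso_iff_bijective]
  constructor
  · intro a b hab
    induction a using Quotient.inductionOn
    induction b using Quotient.inductionOn
    exact Quotient.sound (hF.cohomologous_of_pullback (Quotient.exact hab))
  · intro a
    induction a using Quotient.inductionOn with | _ φ
    obtain ⟨ψ, hψ⟩ := hF.exists_pullback_cohomologous φ
    exact ⟨Quotient.mk _ ψ, Quotient.sound hψ.symm⟩

end Cocycle

end LieGroupoid

/-! ### Local diffeomorphisms, immersions and submersions -/

section LocalDiffeomorph

variable {E H M N : Type*} [NormedAddCommGroup E] [NormedSpace ℝ E]
  [TopologicalSpace H] {I : ModelWithCorners ℝ E H} [TopologicalSpace M] [ChartedSpace H M]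
  [TopologicalSpace N] [ChartedSpace H N] {f : M → N} {x : M}

/-- A smooth map with a smooth inverse between open sets is a local diffeomorphism there. -/
theorem IsLocalDiffeomorphAt.of_localInverse {U : Set M} {V : Set N} {g : N → M}
    (hU : IsOpen U) (hV : IsOpen V) (hx : x ∈ U) (hf : ContMDiffOn I I ∞ f U)
    (hg : ContMDiffOn I I ∞ g V) (hfU : MapsTo f U V) (hgV : MapsTo g V U)
    (h : LeftInvOn g f U) (h' : RightInvOn g f V) : IsLocalDiffeomorphAt I I ∞ f x :=
  ⟨{ toFun := f, invFun := g, source := U, target := V, map_source' := hfU, map_target' := hgV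
     left_inv' := h, right_inv' := h', open_source := hU, open_target := hV
     contMDiffOn_toFun := hf, contMDiffOn_invFun := hg }, hx, fun _ _ => rfl⟩

variable {M' : Type*} [TopologicalSpace M'] [ChartedSpace H M'] 

/-- A map that is a local diffeomorphism on both parts of a disjoint union is one. -/
theorem IsLocalDiffeomorph.sumElim {f' : M' → N} (hf : IsLocalDiffeomorph I I ∞ f)
    (hf' : IsLocalDiffeomorph I I ∞ f') : IsLocalDiffeomorph I I ∞ (Sum.elim f f') := by
  have hs : ContMDiff I I ∞ (Sum.elim f f') := hf.contMDiff.sumElim hf'.contMDiff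
  rintro (x | x)
  · obtain ⟨Φ, hx, h⟩ := hf x
    refine .of_localInverse (U := Sum.inl '' Φ.source) (V := Φ.target)
      (g := Sum.inl ∘ Φ.invFun) (isOpenMap_inl _ Φ.open_source) Φ.open_target
      (mem_image_of_mem _ hx) hs.contMDiffOn
      (ContMDiff.inl.comp_contMDiffOn Φ.contMDiffOn_invFun) ?_ ?_ ?_ ?_
    · rintro _ ⟨y, hy, rfl⟩
      rw [Sum.elim_inl, h hy]
      exact Φ.map_source hy
    · exact fun y hy => mem_image_of_mem _ (Φ.map_target hy)
    · rintro _ ⟨y, hy, rfl⟩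
      rw [Sum.elim_inl, h hy]
      exact congrArg Sum.inl (Φ.left_inv hy)
    · intro y hy
      exact (h (Φ.map_target hy)).trans (Φ.right_inv hy)
  · obtain ⟨Φ, hx, h⟩ := hf' x
    refine .of_localInverse (U := Sum.inr '' Φ.source) (V := Φ.target)
      (g := Sum.inr ∘ Φ.invFun) (isOpenMap_inr _ Φ.open_source) Φ.open_target
      (mem_image_of_mem _ hx) hs.contMDiffOn
      (ContMDiff.inr.comp_contMDiffOn Φ.contMDiffOn_invFun) ?_ ?_ ?_ ?_
    · rintro _ ⟨y, hy, rfl⟩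
      rw [Sum.elim_inr, h hy]
      exact Φ.map_source hy
    · exact fun y hy => mem_image_of_mem _ (Φ.map_target hy)
    · rintro _ ⟨y, hy, rfl⟩
      rw [Sum.elim_inr, h hy]
      exact congrArg Sum.inr (Φ.left_inv hy)
    · intro y hy
      exact (h (Φ.map_target hy)).trans (Φ.right_inv hy)

variable [IsManifold I ∞ M] [IsManifold I ∞ N]

/-- In suitable charts, a local diffeomorphism is the identity. -/
theorem IsLocalDiffeomorphAt.exists_charts (hf : IsLocalDiffeomorphAt I I ∞ f x) :
    ∃ φ ∈ IsManifold.maximalAtlas I ∞ M, ∃ ψ ∈ IsManifold.maximalAtlas I ∞ N, x ∈ φ.source ∧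
      f x ∈ ψ.source ∧
      EqOn (ψ.extend I ∘ f ∘ (φ.extend I).symm) id (φ.extend I).target := by
  obtain ⟨Φ, hx, hΦ⟩ := hf
  set ψ := chartAt H (f x)
  have hψ : ψ ∈ IsManifold.maximalAtlas I ∞ N := IsManifold.chart_mem_maximalAtlas (f x)
  have hfx : Φ x ∈ ψ.source := by rw [← hΦ hx]; exact mem_chart_source H (f x)
  refine ⟨Φ.toOpenPartialHomeomorph.trans ψ, ?_, ψ, hψ, ?_, mem_chart_source H (f x), ?_⟩
  · refine OpenPartialHomeomorph.mem_maximalAtlas_of_contMDiffOn _ ?_ ?_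
    · exact (contMDiffOn_of_mem_maximalAtlas hψ).comp (Φ.contMDiffOn_toFun.mono fun y hy => hy.1)
        fun y hy => hy.2
    · exact Φ.contMDiffOn_invFun.comp
        ((contMDiffOn_symm_of_mem_maximalAtlas hψ).mono fun y hy => hy.1) fun y hy => hy.2
  · exact ⟨hx, hfx⟩
  · rintro y ⟨hy, hy1, hy2⟩
    have h1 : f (Φ.toOpenPartialHomeomorph.symm (ψ.symm (I.symm y))) = ψ.symm (I.symm y) :=
      (hΦ (Φ.toOpenPartialHomeomorph.map_target hy2)).trans
        (Φ.toOpenPartialHomeomorph.right_inv hy2)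
    exact (congrArg (fun z => I (ψ z)) h1).trans
      ((congrArg I (ψ.right_inv hy1)).trans (I.right_inv (by simpa using hy)))

theorem IsLocalDiffeomorph.isSubmersion (hf : IsLocalDiffeomorph I I ∞ f) :
    Manifold.IsSubmersion I I ∞ f := by
  refine Manifold.IsSubmersionOfComplement.isSubmersion (F := PUnit.{1}) fun x => ?_
  obtain ⟨φ, hφ, ψ, hψ, hx, hfx, h⟩ := (hf x).exists_charts
  exact .mk_of_continuousAt hf.contMDiff.continuous.continuousAt
    (ContinuousLinearEquiv.prodUnique ℝ E PUnit).symm φ ψ hx hfx hφ hψ fun y hy => by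
      rw [h hy]; rfl

theorem IsLocalDiffeomorph.isImmersionOfComplement (hf : IsLocalDiffeomorph I I ∞ f) :
    Manifold.IsImmersionOfComplement PUnit.{1} I I ∞ f := fun x => by
  obtain ⟨φ, hφ, ψ, hψ, hx, hfx, h⟩ := (hf x).exists_charts
  exact .mk_of_continuousAt hf.contMDiff.continuous.continuousAt
    (ContinuousLinearEquiv.prodUnique ℝ E PUnit) φ ψ hx hfx hφ hψ fun y hy => by
      rw [h hy]; rfl

end LocalDiffeomorph

section Immersion

variable {E F EX HX EY M X Y : Type*} [NormedAddCommGroup E] [NormedSpace ℝ E]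
  [NormedAddCommGroup F] [NormedSpace ℝ F]
  [NormedAddCommGroup EX] [NormedSpace ℝ EX] [TopologicalSpace HX]
  [NormedAddCommGroup EY] [NormedSpace ℝ EY] {I : ModelWithCorners ℝ EX HX}
  [TopologicalSpace M] [ChartedSpace E M] [TopologicalSpace X] [ChartedSpace HX X]
  [TopologicalSpace Y] [ChartedSpace EY Y]

/-- The shear `(u, v) ↦ (u, v - h u)` over an open set `U`, as a partial homeomorphism. -/
def shear (h : HX → EY) (U : Set HX) (hU : IsOpen U) (hh : ContinuousOn h U) :
    OpenPartialHomeomorph (HX × EY) (HX × EY) where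
  toFun z := (z.1, z.2 - h z.1)
  invFun z := (z.1, z.2 + h z.1)
  source := U ×ˢ univ
  target := U ×ˢ univ
  map_source' z hz := ⟨hz.1, trivial⟩
  map_target' z hz := ⟨hz.1, trivial⟩
  left_inv' z _ := by simp
  right_inv' z _ := by simp
  open_source := hU.prod isOpen_univ
  open_target := hU.prod isOpen_univ
  continuousOn_toFun := continuousOn_fst.prodMk
    (continuousOn_snd.sub (hh.comp continuousOn_fst fun _ hz => hz.1))
  continuousOn_invFun := continuousOn_fst.prodMk
    (continuousOn_snd.add (hh.comp continuousOn_fst fun _ hz => hz.1))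

variable [IsManifold I ∞ X] [IsManifold 𝓘(ℝ, EY) ∞ Y]

/-- If `i` is an immersion and `q` is smooth, then `(i, q)` is an immersion: in coordinates in
which `i` is `u ↦ (u, 0)`, the graph of `q` is straightened by a shear. -/
theorem Manifold.IsImmersionOfComplement.prodMk {i : M → X} {q : M → Y}
    (hi : IsImmersionOfComplement F 𝓘(ℝ, E) I ∞ i) (hq : ContMDiff 𝓘(ℝ, E) 𝓘(ℝ, EY) ∞ q) :
    IsImmersionOfComplement (F × EY) 𝓘(ℝ, E) (I.prod 𝓘(ℝ, EY)) ∞ (fun x => (i x, q x)) := by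
  intro x
  have h := hi x
  set θ := h.domChart
  set φ := h.codChart
  set e := h.equiv
  set ψ := chartAt EY (q x)
  have hθ : θ ∈ IsManifold.maximalAtlas 𝓘(ℝ, E) ∞ M := h.domChart_mem_maximalAtlas
  have hφ : φ ∈ IsManifold.maximalAtlas I ∞ X := h.codChart_mem_maximalAtlas
  have hψ : ψ ∈ IsManifold.maximalAtlas 𝓘(ℝ, EY) ∞ Y := IsManifold.chart_mem_maximalAtlas (q x)
  have hxθ : x ∈ θ.source := h.mem_domChart_source
  have hxφ : i x ∈ φ.source := h.mem_codChart_source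
  have hxψ : q x ∈ ψ.source := mem_chart_source EY (q x)
  have key : ∀ u ∈ θ.target, I (φ (i (θ.symm u))) = e (u, 0) := fun u hu => by
    simpa using h.writtenInCharts (show u ∈ (θ.extend 𝓘(ℝ, E)).target by simpa using hu)
  -- `r` retracts the coordinates of `X` onto those of `M`, and `k ∘ r` expresses `q` in terms of `i`
  let r : HX → E := fun a => (e.symm (I a)).1
  have hr : ContMDiff I 𝓘(ℝ, E) ∞ r :=
    (contDiff_fst.comp e.symm.contDiff).contMDiff.comp I.contMDiff
  let W : Set E := θ.target ∩ θ.symm ⁻¹' (q ⁻¹' ψ.source)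
  have hW : IsOpen W := θ.symm.isOpen_inter_preimage (ψ.open_source.preimage hq.continuous)
  let k : E → EY := fun u => ψ (q (θ.symm u))
  have hk : ContMDiffOn 𝓘(ℝ, E) 𝓘(ℝ, EY) ∞ k W :=
    (contMDiffOn_of_mem_maximalAtlas hψ).comp (hq.comp_contMDiffOn
      ((contMDiffOn_symm_of_mem_maximalAtlas hθ).mono inter_subset_left)) fun u hu => hu.2
  have hkr : ContMDiffOn I 𝓘(ℝ, EY) ∞ (k ∘ r) (r ⁻¹' W) :=
    hk.comp hr.contMDiffOn fun a ha => ha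
  let S := shear (k ∘ r) (r ⁻¹' W) (hW.preimage hr.continuous) hkr.continuousOn
  have hS : ContMDiffOn (M := ModelProd HX EY) (M' := ModelProd HX EY) (I.prod 𝓘(ℝ, EY))
      (I.prod 𝓘(ℝ, EY)) ∞ S S.source := by
    have h : ContMDiffOn (I.prod 𝓘(ℝ, EY)) (I.prod 𝓘(ℝ, EY)) ∞ S S.source :=
      contMDiffOn_fst.prodMk
        (contMDiffOn_snd.sub (hkr.comp contMDiffOn_fst fun _ hz => hz.1))
    rw [chartedSpaceSelf_prod] at h
    exact h
  have hS' : ContMDiffOn (M := ModelProd HX EY) (M' := ModelProd HX EY) (I.prod 𝓘(ℝ, EY))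
      (I.prod 𝓘(ℝ, EY)) ∞ S.symm S.target := by
    have h : ContMDiffOn (I.prod 𝓘(ℝ, EY)) (I.prod 𝓘(ℝ, EY)) ∞ S.symm S.target :=
      contMDiffOn_fst.prodMk
        (contMDiffOn_snd.add (hkr.comp contMDiffOn_fst fun _ hz => hz.1))
    rw [chartedSpaceSelf_prod] at h
    exact h
  have hφψ : φ.prod ψ ∈ IsManifold.maximalAtlas (I.prod 𝓘(ℝ, EY)) ∞ (X × Y) :=
    IsManifold.mem_maximalAtlas_prod hφ hψ
  have hrx : ∀ u ∈ θ.target, r (φ (i (θ.symm u))) = u := fun u hu => by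
    simp only [r, key u hu, e.symm_apply_apply]
  refine .mk_of_continuousAt (hi.contMDiff.continuous.prodMk hq.continuous).continuousAt
    ((ContinuousLinearEquiv.prodAssoc ℝ E F EY).symm.trans
      (e.prodCongr (ContinuousLinearEquiv.refl ℝ EY)))
    θ ((φ.prod ψ).trans S) hxθ ?_ hθ ?_ ?_
  · refine ⟨⟨hxφ, hxψ⟩, ?_, trivial⟩
    have := hrx (θ x) (θ.map_source hxθ)
    rw [θ.left_inv hxθ] at this
    change r (φ (i x)) ∈ W
    rw [this]
    exact ⟨θ.map_source hxθ, by simpa only [mem_preimage, θ.left_inv hxθ] using hxψ⟩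
  · refine OpenPartialHomeomorph.mem_maximalAtlas_of_contMDiffOn _ ?_ ?_
    · exact hS.comp ((contMDiffOn_of_mem_maximalAtlas hφψ).mono fun y hy => hy.1) fun y hy => hy.2
    · exact (contMDiffOn_symm_of_mem_maximalAtlas hφψ).comp (hS'.mono fun y hy => hy.1)
        fun y hy => hy.2
  · intro u hu
    have hu : u ∈ θ.target := by simpa using hu
    change (I (φ (i (θ.symm u))), ψ (q (θ.symm u)) - k (r (φ (i (θ.symm u))))) = (e (u, 0), 0)
    rw [hrx u hu, key u hu, sub_self]

end Immersion

/-! ### The squaring map of the circle -/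

namespace Circle

instance : LieGroup (𝓡 1) ∞ Circle := LieGroup.of_le (n := ω) le_top

theorem contMDiff_neg : ContMDiff (𝓡 1) (𝓡 1) ∞ (fun z : Circle => -z) := by
  have h : ContMDiff (𝓡 1) (𝓡 1) ∞ (fun z : Circle => (-1 : Circle) * z) :=
    contMDiff_const.mul contMDiff_id
  simpa using h

theorem contMDiff_sq : ContMDiff (𝓡 1) (𝓡 1) ∞ (fun z : Circle => z * z) :=
  contMDiff_id.mul contMDiff_id

theorem exp_pi : Circle.exp Real.pi = -1 :=
  Circle.ext (by rw [Circle.coe_exp, Complex.exp_pi_mul_I]; rfl)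

theorem mul_self_eq_mul_self {z w : Circle} : z * z = w * w ↔ z = w ∨ z = -w := by
  simp only [Circle.ext_iff, Circle.coe_mul, _root_.mul_self_eq_mul_self_iff]
  rfl

/-- The square root in the right half plane, of a point of the circle other than `-1`. -/
noncomputable def sqrt (z : Circle) : Circle := Circle.exp ((z : ℂ).arg / 2)

theorem sqrt_mul_self (z : Circle) : sqrt z * sqrt z = z := by
  rw [sqrt, ← Circle.exp_add, add_halves, Circle.exp_arg]

theorem mem_slitPlane {z : Circle} (hz : z ≠ -1) : (z : ℂ) ∈ Complex.slitPlane := by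
  rw [Complex.mem_slitPlane_iff_arg]
  refine ⟨fun h => hz ?_, z.coe_ne_zero⟩
  rw [← Circle.exp_arg z, h, Circle.exp_pi]

theorem sqrt_re_pos {z : Circle} (hz : z ≠ -1) : 0 < (sqrt z : ℂ).re := by
  have h := Complex.neg_pi_lt_arg (z : ℂ)
  have h' := lt_of_le_of_ne (Complex.arg_le_pi (z : ℂ))
    (Complex.mem_slitPlane_iff_arg.1 (mem_slitPlane hz)).1
  rw [sqrt, Circle.coe_exp, Complex.exp_ofReal_mul_I_re]
  exact Real.cos_pos_of_mem_Ioo ⟨by linarith, by linarith⟩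

theorem mul_self_ne_neg_one {z : Circle} (hz : 0 < (z : ℂ).re) : z * z ≠ -1 := fun h => by
  have h1 : (z : ℂ) * z = -1 := congrArg (fun z : Circle => (z : ℂ)) h
  have h2 := congrArg Complex.re h1
  have h3 := congrArg Complex.im h1
  simp only [Complex.mul_re, Complex.mul_im, Complex.neg_re, Complex.neg_im, Complex.one_re,
    Complex.one_im] at h2 h3
  have h4 : (z : ℂ).im = 0 := by
    have : (z : ℂ).re * (z : ℂ).im = 0 := by linarith
    exact (mul_eq_zero.1 this).resolve_left hz.ne'
  rw [h4] at h2
  nlinarith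

theorem sqrt_of_mul_self {z : Circle} (hz : 0 < (z : ℂ).re) : sqrt (z * z) = z := by
  have h := sqrt_re_pos (mul_self_ne_neg_one hz)
  refine (mul_self_eq_mul_self.1 (sqrt_mul_self (z * z))).resolve_right fun e => ?_
  rw [e] at h
  have : ((-z : Circle) : ℂ).re = -(z : ℂ).re := rfl
  linarith

theorem contMDiffOn_sqrt : ContMDiffOn (𝓡 1) (𝓡 1) ∞ sqrt {-1}ᶜ := by
  have hcoe : ContMDiff (𝓡 1) 𝓘(ℝ, ℂ) ∞ (fun z : Circle => (z : ℂ)) :=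
    haveI := finrank_real_complex_fact'
    contMDiff_coe_sphere (E := ℂ)
  have harg : ContMDiffOn 𝓘(ℝ, ℂ) 𝓘(ℝ, ℝ) ∞ (fun z : ℂ => z.arg / 2) Complex.slitPlane := by
    rw [contMDiffOn_iff_contDiffOn]
    intro z hz
    have h : ContDiffAt ℝ ∞ Complex.log z := (Complex.contDiffAt_log hz).restrict_scalars ℝ
    simp only [← Complex.log_im]
    exact ((Complex.imCLM.contDiff.contDiffAt.comp z h).div_const 2).contDiffWithinAt
  exact contMDiff_circleExp.comp_contMDiffOn
    (harg.comp hcoe.contMDiffOn fun z hz => mem_slitPlane hz)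

/-- The square root close to `a`, of points of the circle other than `-a²`. -/
noncomputable def sqrtNear (a z : Circle) : Circle := a * sqrt (z / (a * a))

theorem sqrtNear_mul_self (a z : Circle) : sqrtNear a z * sqrtNear a z = z := by
  rw [sqrtNear, mul_mul_mul_comm, sqrt_mul_self, mul_div_cancel]

theorem contMDiffOn_sqrtNear (a : Circle) :
    ContMDiffOn (𝓡 1) (𝓡 1) ∞ (sqrtNear a) {-(a * a)}ᶜ := by
  have h : ContMDiff (𝓡 1) (𝓡 1) ∞ (fun z : Circle => z / (a * a)) :=
    contMDiff_id.div contMDiff_const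
  refine contMDiffOn_const.mul (contMDiffOn_sqrt.comp h.contMDiffOn fun z hz => ?_)
  intro e
  refine hz ?_
  have e : z / (a * a) = -1 := e
  rw [div_eq_iff_eq_mul] at e
  simpa using e

theorem isLocalDiffeomorph_sq : IsLocalDiffeomorph (𝓡 1) (𝓡 1) ∞ (fun z : Circle => z * z) := by
  intro a
  have hdiv : ∀ z : Circle, z * z / (a * a) = (z / a) * (z / a) := fun z =>
    (div_mul_div_comm z a z a).symm
  have hne : ∀ {z : Circle}, z ≠ -(a * a) ↔ z / (a * a) ≠ -1 := fun {z} => by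
    rw [not_iff_not, div_eq_iff_eq_mul, neg_one_mul]
  refine .of_localInverse (U := {z | 0 < ((z / a : Circle) : ℂ).re}) (V := {-(a * a)}ᶜ)
    (g := sqrtNear a) ?_ isOpen_compl_singleton ?_ contMDiff_sq.contMDiffOn
    (contMDiffOn_sqrtNear a) ?_ ?_ ?_ ?_
  · exact isOpen_lt continuous_const (Complex.continuous_re.comp
      (continuous_subtype_val.comp (continuous_div_right' a)))
  · simp
  · intro z hz
    exact hne.2 (by rw [hdiv]; exact mul_self_ne_neg_one hz)
  · intro z hz
    change 0 < ((sqrtNear a z / a : Circle) : ℂ).re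
    rw [sqrtNear, mul_div_cancel_left]
    exact sqrt_re_pos (hne.1 hz)
  · intro z hz
    simp only [sqrtNear]
    rw [hdiv, sqrt_of_mul_self hz, mul_div_cancel]
  · intro z _
    exact sqrtNear_mul_self a z

theorem isLocalDiffeomorph_neg : IsLocalDiffeomorph (𝓡 1) (𝓡 1) ∞ (fun z : Circle => -z) :=
  fun _ => .of_localInverse (U := univ) (V := univ) isOpen_univ isOpen_univ trivial
    contMDiff_neg.contMDiffOn contMDiff_neg.contMDiffOn (mapsTo_univ _ _) (mapsTo_univ _ _)
    (fun z _ => neg_neg z) (fun z _ => neg_neg z)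

theorem isLocalDiffeomorph_id : IsLocalDiffeomorph (𝓡 1) (𝓡 1) ∞ (fun z : Circle => z) :=
  fun _ => .of_localInverse (U := univ) (V := univ) isOpen_univ isOpen_univ trivial
    contMDiff_id.contMDiffOn contMDiff_id.contMDiffOn (mapsTo_univ _ _) (mapsTo_univ _ _)
    (fun _ _ => rfl) (fun _ _ => rfl)

end Circle

namespace LieGroupoid

/-! ### The action groupoid of the antipodal involution -/

/-- The groupoid of the antipodal action of `ℤ/2` on the circle, with the arrows `S¹ × ℤ/2` given as
`S¹ ⊔ S¹`. The arrow `inl z` is the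
identity of `z`, and `inr z` is the arrow `z → -z`. -/
noncomputable def antipodal : LieGroupoid where
  Obj := Mfd.of Circle 1
  Arr := Mfd.of (Circle ⊕ Circle) 1
  src := Sum.elim (fun z => z) (fun z => z)
  tgt := Sum.elim (fun z => z) (fun z => -z)
  unit z := Sum.inl z
  inv := Sum.map (fun z => z) (fun z => -z)
  comp g h _ := Sum.elim (fun _ => h) (fun _ => Sum.swap h) g
  src_unit _ := rfl
  tgt_unit _ := rfl
  src_inv := by rintro (z | z) <;> rfl
  tgt_inv := by rintro (z | z); exacts [rfl, neg_neg z]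
  src_comp := by rintro (z | z) (w | w) _ <;> rfl
  tgt_comp := by
    rintro (z | z) (w | w) e
    · exact e.symm
    · exact e.symm
    · exact congrArg (fun z : Circle => -z) e.symm
    · have e : z = -w := e
      change w = -z
      rw [e, neg_neg]
  unit_comp _ := rfl
  comp_unit := by rintro (z | z) <;> rfl
  inv_comp := by rintro (z | z) <;> rfl
  comp_inv := by rintro (z | z) <;> rfl
  assoc := by rintro (z | z) (w | w) (x | x) _ _ <;> rfl
  submersion_src := (Circle.isLocalDiffeomorph_id.sumElim Circle.isLocalDiffeomorph_id).isSubmersion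
  submersion_tgt :=
    (Circle.isLocalDiffeomorph_id.sumElim Circle.isLocalDiffeomorph_neg).isSubmersion
  smooth_unit := ContMDiff.inl
  smooth_inv := contMDiff_id.sumMap Circle.contMDiff_neg
  smooth_comp := by
    rintro m hm ⟨g, h⟩ e
    rcases g with z | z
    · refine contMDiffWithinAt_snd.congr_of_eventuallyEq ?_ (hm _ _ e)
      filter_upwards [self_mem_nhdsWithin, mem_nhdsWithin_of_mem_nhds
        ((isOpen_range_inl.preimage continuous_fst).mem_nhds (mem_range_self z))]
      rintro ⟨_, h'⟩ he ⟨w, rfl⟩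
      exact hm _ _ he
    · refine (ContMDiff.swap.contMDiffAt.comp_contMDiffWithinAt _
        contMDiffWithinAt_snd).congr_of_eventuallyEq ?_ (hm _ _ e)
      filter_upwards [self_mem_nhdsWithin, mem_nhdsWithin_of_mem_nhds
        ((isOpen_range_inr.preimage continuous_fst).mem_nhds (mem_range_self z))]
      rintro ⟨_, h'⟩ he ⟨w, rfl⟩
      exact hm _ _ he

/-- The squaring map as a functor to the circle, which is the quotient by the antipodal action. -/
noncomputable def squaring : SmoothFunctor antipodal circle where
  obj := fun z : Circle => z * z
  arr := Sum.elim (fun z : Circle => z * z) (fun z : Circle => z * z)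
  smooth_obj := Circle.contMDiff_sq
  smooth_arr := Circle.contMDiff_sq.sumElim Circle.contMDiff_sq
  src_arr := by rintro (z | z) <;> rfl
  tgt_arr := by rintro (z | z); exacts [rfl, (neg_mul_neg z z).symm]
  arr_unit _ := rfl
  arr_comp := by
    rintro (z | z) (w | w) e
    · exact congrArg (fun z : Circle => z * z) e.symm
    · have e : z = -w := e
      change w * w = z * z
      rw [e, neg_mul_neg]
    · exact congrArg (fun z : Circle => z * z) e.symm
    · have e : z = -w := e
      change w * w = z * z
      rw [e, neg_mul_neg]

theorem squaring_isEquivalence : squaring.IsEquivalence where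
  arrows := by
    have hs := (Circle.isLocalDiffeomorph_id.sumElim
      Circle.isLocalDiffeomorph_id).isImmersionOfComplement
    have himm := ((hs.prodMk antipodal.submersion_tgt.contMDiff).prodMk
      squaring.smooth_arr).isImmersion
    refine ⟨⟨himm, ?_⟩, ?_⟩
    · refine (himm.contMDiff.continuous.isClosedEmbedding ?_).isEmbedding
      rintro (z | z) (w | w) h
      · exact congrArg (fun p => Sum.inl p.1.1) h
      · have h1 : z = w := congrArg (fun p => p.1.1) h
        have h2 : z = -w := congrArg (fun p => p.1.2) h
        exact absurd (h2.symm.trans h1) w.neg_ne_self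
      · have h1 : z = w := congrArg (fun p => p.1.1) h
        have h2 : -z = w := congrArg (fun p => p.1.2) h
        exact absurd (h2.trans h1.symm) z.neg_ne_self
      · exact congrArg (fun p => Sum.inr p.1.1) h
    · refine Subset.antisymm ?_ ?_
      · rintro _ ⟨z | z, rfl⟩
        · rfl
        · exact Prod.ext rfl (neg_mul_neg (α := Circle) z z)
      · rintro ⟨⟨(z : Circle), (w : Circle)⟩, (y : Circle)⟩ h
        have h1 : z * z = y := congrArg Prod.fst h
        have h2 : w * w = y := congrArg Prod.snd h
        rcases Circle.mul_self_eq_mul_self.1 (h2.trans h1.symm) with rfl | rfl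
        · exact ⟨Sum.inl w, Prod.ext rfl h1⟩
        · exact ⟨Sum.inr z, Prod.ext rfl h1⟩
  objects := by
    have himm := (Circle.isLocalDiffeomorph_id.isImmersionOfComplement.prodMk
      Circle.contMDiff_sq).isImmersion
    refine ⟨Mfd.of Circle 1, fun z => z, fun z : Circle => z * z, ⟨⟨himm, ?_⟩, ?_⟩,
      Circle.isLocalDiffeomorph_sq.isSubmersion, fun z => ⟨_, Circle.sqrt_mul_self z⟩⟩
    · exact (himm.contMDiff.continuous.isClosedEmbedding fun z w h =>
        congrArg Prod.fst h).isEmbedding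
    · refine Subset.antisymm ?_ ?_
      · rintro _ ⟨z, rfl⟩
        rfl
      · rintro ⟨z, w⟩ h
        exact ⟨z, Prod.ext rfl h⟩

/-- The functor to `{ℤ/2 ⇉ *}` given by the acting group element. It classifies the double cover
`z ↦ z²` of the circle. -/
noncomputable def doubleCover : SmoothFunctor antipodal BZ2 where
  obj _ := ()
  arr := Sum.elim (fun _ => (1 : Multiplicative (ZMod 2)))
    (fun _ => (Multiplicative.ofAdd 1 : Multiplicative (ZMod 2)))
  smooth_obj := contMDiff_const
  smooth_arr := ContMDiff.sumElim (I := 𝓡 1) (M := Circle) (M' := Circle) contMDiff_const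
    contMDiff_const
  src_arr _ := rfl
  tgt_arr _ := rfl
  arr_unit _ := rfl
  arr_comp := by
    rintro (z | z) (w | w) _
    · rfl
    · rfl
    · rfl
    · exact (by decide : (1 : Multiplicative (ZMod 2)) =
        Multiplicative.ofAdd 1 * Multiplicative.ofAdd 1)

/-- The constant functor `S¹ → {ℤ/2 ⇉ *}`, which classifies the trivial double cover. -/
noncomputable def trivialCover : SmoothFunctor circle BZ2 where
  obj _ := ()
  arr _ := (1 : Multiplicative (ZMod 2))
  smooth_obj := contMDiff_const
  smooth_arr := contMDiff_const
  src_arr _ := rfl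
  tgt_arr _ := rfl
  arr_unit _ := rfl
  arr_comp _ _ _ := rfl

/-- The arc `S¹ ∖ {-a²}`. -/
def arc (a : Circle) : Opens Circle := ⟨{-(a * a)}ᶜ, isOpen_compl_singleton⟩

theorem contMDiff_sqrtNear_arc (a : Circle) :
    ContMDiff (𝓡 1) (𝓡 1) ∞ (fun z : arc a => Circle.sqrtNear a z) :=
  (Circle.contMDiffOn_sqrtNear a).comp_contMDiff contMDiff_subtype_val fun z => z.2

/-- A square root on the arc `S¹ ∖ {-a²}`, as a section of the squaring functor. -/
noncomputable def arcSection (a : Circle) : SmoothFunctor (circleOpen (arc a)) antipodal where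
  obj := fun z : arc a => Circle.sqrtNear a z
  arr := fun z : arc a => Sum.inl (Circle.sqrtNear a z)
  smooth_obj := contMDiff_sqrtNear_arc a
  smooth_arr := (ContMDiff.inl (I := 𝓡 1) (M := Circle) (M' := Circle)).comp
    (contMDiff_sqrtNear_arc a)
  src_arr _ := rfl
  tgt_arr _ := rfl
  arr_unit _ := rfl
  arr_comp := fun (z w : arc a) (e : z = w) => by subst e; rfl

theorem arcSection_squaring (a : Circle) :
    (arcSection a).cls ≫ squaring.cls = inclusion (arc a) := by
  have h : (arcSection a).comp squaring = ofMap (M := Mfd.of (arc a) 1) (N := Mfd.of Circle 1)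
      Subtype.val contMDiff_subtype_val :=
    SmoothFunctor.ext (funext fun z : arc a => Circle.sqrtNear_mul_self a z)
      (funext fun z : arc a => Circle.sqrtNear_mul_self a z)
  exact congrArg SmoothFunctor.cls h

theorem arcSection_doubleCover (a : Circle) :
    (arcSection a).cls ≫ doubleCover.cls = inclusion (arc a) ≫ trivialCover.cls := by
  have h : (arcSection a).comp doubleCover = (ofMap (M := Mfd.of (arc a) 1)
      (N := Mfd.of Circle 1) Subtype.val contMDiff_subtype_val).comp trivialCover :=
    SmoothFunctor.ext rfl rfl
  exact congrArg SmoothFunctor.cls h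

/-! ### Non-triviality of the double cover -/

/-- The tautological cocycle on `{ℤ/2 ⇉ *}`, which encodes the universal double cover
`* → {ℤ/2 ⇉ *}`. -/
def tautologicalCocycle : Cocycle (ZMod 2) BZ2 where
  val := fun g : Multiplicative (ZMod 2) => g.toAdd
  gauge _ _ := 0
  val_mul := fun {g h} e => by rw [mul_eq e]; rfl
  continuousAt _ := (continuous_of_discreteTopology (α := Mfd.discrete _)).continuousAt

/-- If the two classes agreed, a continuous `ℤ/2`-valued function on the circle would take different
values at `1` and `-1`. -/
theorem H1_doubleCover_ne : (H1.functor (ZMod 2)).map doubleCover.cls ≠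
    (H1.functor (ZMod 2)).map (squaring.cls ≫ trivialCover.cls) := fun h => by
  have h1 : H1.map (ZMod 2) doubleCover.cls (Quotient.mk _ tautologicalCocycle) =
      H1.map (ZMod 2) (squaring.comp trivialCover).cls
        (Quotient.mk _ tautologicalCocycle) :=
    ConcreteCategory.congr_hom (Quiver.Hom.op_inj h) (Quotient.mk _ tautologicalCocycle)
  obtain ⟨c, hc, hc'⟩ : Cohomologous _ _ := Quotient.exact h1
  have hcont : Continuous fun z : Circle => c z := continuous_iff_continuousAt.2 fun z => by
    have := (hc' z).neg
    refine this.congr (.of_forall fun w => ?_)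
    simp [Cocycle.pullback, tautologicalCocycle]
  have hconst : c (-1 : Circle) = c (1 : Circle) := 
    PreconnectedSpace.constant (α := Circle) inferInstance hcont
  have h2 : (0 : ZMod 2) - 1 = c (-1 : Circle) - c (1 : Circle) := hc (Sum.inr (1 : Circle))
  rw [hconst, sub_self] at h2
  exact absurd h2 (by decide)

end LieGroupoid

theorem lemma3 :
    ∃ U₁ U₂ : Opens Circle, U₁ ⊔ U₂ = ⊤ ∧
      ∀ (D : Type u) [Category.{v} D] (L : LieGroupoid ⥤ D)
        [L.IsLocalization LieGroupoid.equivalences],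
        ∃ f g : L.obj LieGroupoid.circle ⟶ L.obj LieGroupoid.BZ2,
          L.map (LieGroupoid.inclusion U₁) ≫ f = L.map (LieGroupoid.inclusion U₁) ≫ g ∧
          L.map (LieGroupoid.inclusion U₂) ≫ f = L.map (LieGroupoid.inclusion U₂) ≫ g ∧
          f ≠ g := by
  -- the arcs on which the roots `√z` and `i √(-z)` are defined; `a` is the imaginary unit
  let a : Circle := Circle.exp (Real.pi / 2)
  have ha : a * a = -1 := by rw [← Circle.exp_add, add_halves, Circle.exp_pi]
  refine ⟨LieGroupoid.arc 1, LieGroupoid.arc a, ?_, fun D _ L _ => ?_⟩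
  · ext z
    change (z ∈ ({-(1 * 1)}ᶜ : Set Circle) ∨ z ∈ ({-(a * a)}ᶜ : Set Circle)) ↔ True
    simp only [ha, mem_compl_iff, mem_singleton_iff, mul_one, neg_neg, iff_true]
    by_contra! h
    exact Circle.neg_ne_self 1 (h.1.symm.trans h.2)
  have hiso : IsIso (L.map LieGroupoid.squaring.cls) :=
    Localization.inverts L LieGroupoid.equivalences _ ⟨_, LieGroupoid.squaring_isEquivalence, rfl⟩
  have key : ∀ b : Circle, L.map (LieGroupoid.inclusion (LieGroupoid.arc b)) ≫
      L.map LieGroupoid.trivialCover.cls =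
      L.map (LieGroupoid.inclusion (LieGroupoid.arc b)) ≫
        inv (L.map LieGroupoid.squaring.cls) ≫ L.map LieGroupoid.doubleCover.cls := fun b => by
    rw [← L.map_comp, ← LieGroupoid.arcSection_doubleCover, ← LieGroupoid.arcSection_squaring,
      L.map_comp, L.map_comp, Category.assoc, IsIso.hom_inv_id_assoc]
  -- equality would persist under every functor inverting the equivalences, in particular under `H¹`
  refine ⟨_, _, key 1, key a, fun h => LieGroupoid.H1_doubleCover_ne ?_⟩
  rw [IsIso.eq_inv_comp, ← L.map_comp] at h
  have e := Localization.fac (LieGroupoid.H1.functor (ZMod 2))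
    (LieGroupoid.H1.isInvertedBy (ZMod 2)) L
  have hL := congrArg (Localization.lift (LieGroupoid.H1.functor (ZMod 2))
    (LieGroupoid.H1.isInvertedBy (ZMod 2)) L).map h.symm
  rw [← NatIso.naturality_1 e, ← NatIso.naturality_1 e]
  simp only [Functor.comp_map, hL]
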